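/- Let $n,m\in\mathbb{N}$, $A\in\mathbb{R}^{n\times n}$, $B\in\mathbb{R}^{n\times m}$. A set in $\mathbb{R}^p$ is a *proper $C$-set* if it is compact, convex and contains the origin in its interior. For a set $\mathcal{X}\subseteq\mathbb{R}^p$ with $0\in\mathcal{X}$ let $\mathcal{X}^*=\{x:\ y^Tx\le 1\ \text{for all } y\in\mathcal{X}\}$ be its polar, and for a proper $C$-set $\mathcal{X}$ let $g_{\mathcal{X}}(y)=\min\{\eta\ge 0:\ y\in\eta\mathcal{X}\}$ be its Minkowski function. Let $\oplus$ be Minkowski addition, $P_x=(I\ O)\in\mathbb{R}^{n\times(n+m)}$ the projection $(x,u)\mapsto x$, and let convergence of nonempty compact convex sets be with respect to the Hausdorff distance. Suppose that $(A,B)$ is strictly stabilizable (the map induced by $A$ on the quotient of $\mathbb{R}^n$ by the controllable subspace $\sum_{k\ge0}\operatorname{range}(A^kB)$ has all its complex eigenvalues in the open unit disc), that $\mathcal{C}$ is a proper $C$-set in $\mathbb{R}^{n+m}$, and that $\mathcal{Q}_f$ is a proper $C$-set in $\mathbb{R}^n$. Let $\mathcal{L}\subseteq\mathcal{Q}_f$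 be a proper $C$-set in $\mathbb{R}^n$ such that for every $x\in\mathbb{R}^n$ there is a $u\in\mathbb{R}^m$ with $$g_{\mathcal{L}}(Ax+Bu)+g_{\mathcal{C}}((x,u))\le g_{\mathcal{L}}(x).$$ Given $\mathcal{P}_0$, define for all $k\ge 0$ $$\mathcal{T}_{k+1}=\left(\mathcal{C}^*\oplus(A\ B)^T\mathcal{P}_k^*\right)^*,\qquad \mathcal{P}_{k+1}=P_x\mathcal{T}_{k+1}.$$ Let $\mathcal{P}_k,\mathcal{T}_k$ be the sets obtained from $\mathcal{P}_0=\mathcal{Q}_f$ (arbitrary iterates), $\underline{\mathcal{P}}_k$ those obtained from $\underline{\mathcal{P}}_0=\mathbb{R}^n$, i.e. $\underline{\mathcal{P}}_0^*=\{0\}$ (lower iterates), and $\overline{\mathcal{P}}_k$ those obtained from $\overline{\mathcal{P}}_0=\mathcal{L}$ (upper iterates). Then: (i) The sequence $\{\mathcal{P}_k\}_{k\ge1}$ converges to a proper $C$-set $\mathcal{P}_\infty$ in $\mathbb{R}^n$. (ii) The sequences $\{\underline{\mathcal{P}}_k\}_{k\ge1}$ and $\{\overline{\mathcal{P}}_k\}_{k\ge1}$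 converge, and their limits $\underline{\mathcal{P}}_\infty$, $\overline{\mathcal{P}}_\infty$ satisfy $\overline{\mathcal{P}}_\infty=\mathcal{P}_\infty=\underline{\mathcal{P}}_\infty$. (iii) The sequence $\{\mathcal{T}_k\}_{k\ge1}$ converges to a proper $C$-set $\mathcal{T}_\infty$ in $\mathbb{R}^{n+m}$ with $$\mathcal{T}_\infty=\left(\mathcal{C}^*\oplus(A\ B)^T\mathcal{P}_\infty^*\right)^*\quad\text{and}\quad \mathcal{P}_\infty=P_x\mathcal{T}_\infty.$$ (iv) $\mathcal{P}_\infty$ solves the fixed point set equation $\mathcal{P}=P_x\left(\mathcal{C}^*\oplus(A\ B)^T\mathcal{P}^*\right)^*$. -/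

import Mathlib

open Filter Topology
open scoped Pointwise

noncomputable section

namespace MinkowskiBellman

/-- A `C`-set: compact, convex, containing the origin. -/
structure IsCSet {ι : Type*} [Fintype ι] (X : Set (EuclideanSpace ℝ ι)) : Prop where
  isCompact : IsCompact X
  convex : Convex ℝ X
  zero_mem : (0 : EuclideanSpace ℝ ι) ∈ X

/-- A proper `C`-set: a `C`-set containing the origin in its interior. -/
structure IsProperCSet {ι : Type*} [Fintype ι] (X : Set (EuclideanSpace ℝ ι)) : Prop
    extends IsCSet X where
  zero_mem_interior : (0 : EuclideanSpace ℝ ι) ∈ interior X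

/-- The (one-sided) polar set `X^* = {x | ∀ y ∈ X, yᵀ x ≤ 1}`. -/
def polar {ι : Type*} [Fintype ι] (X : Set (EuclideanSpace ℝ ι)) : Set (EuclideanSpace ℝ ι) :=
  {x | ∀ y ∈ X, inner ℝ y x ≤ 1}

/-- The image `M X = {M x | x ∈ X}` of a set under a matrix. -/
def matImage {ι κ : Type*} [Fintype ι] [Fintype κ] [DecidableEq κ] (M : Matrix ι κ ℝ)
    (X : Set (EuclideanSpace ℝ κ)) : Set (EuclideanSpace ℝ ι) :=
  (fun x => Matrix.toEuclideanLin M x) '' X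

/-- Convergence with respect to the Hausdorff distance of a sequence of nonempty compact convex
sets to a nonempty compact convex set. -/
structure HausdorffTendsto {ι : Type*} [Fintype ι] (S : ℕ → Set (EuclideanSpace ℝ ι))
    (L : Set (EuclideanSpace ℝ ι)) : Prop where
  terms : ∀ k, (S k).Nonempty ∧ IsCompact (S k) ∧ Convex ℝ (S k)
  limit : L.Nonempty ∧ IsCompact L ∧ Convex ℝ L
  tendsto : Tendsto (fun k => Metric.hausdorffDist (S k) L) atTop (𝓝 0)

variable {n m : ℕ}

/-- The vector `(x, u)` of `ℝ^{n+m}`. -/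
def pair (x : EuclideanSpace ℝ (Fin n)) (u : EuclideanSpace ℝ (Fin m)) :
    EuclideanSpace ℝ (Fin n ⊕ Fin m) :=
  WithLp.toLp 2 (Sum.elim (fun i => x i) (fun j => u j))

/-- The projection matrix `P_x = (I O)`. -/
def projX (n m : ℕ) : Matrix (Fin n) (Fin n ⊕ Fin m) ℝ := Matrix.fromCols 1 0

/-- The controllable subspace of `(A, B)`, the sum of the ranges of `A ^ k B`, `k ∈ ℕ`. -/
def controllableSubspace (A : Matrix (Fin n) (Fin n) ℝ) (B : Matrix (Fin n) (Fin m) ℝ) :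
    Submodule ℝ (Fin n → ℝ) :=
  ⨆ k : ℕ, LinearMap.range (Matrix.toLin' (A ^ k * B))

theorem controllableSubspace_le_comap (A : Matrix (Fin n) (Fin n) ℝ)
    (B : Matrix (Fin n) (Fin m) ℝ) :
    controllableSubspace A B ≤ (controllableSubspace A B).comap (Matrix.toLin' A) := by
  unfold controllableSubspace
  refine iSup_le fun k => ?_
  rintro _ ⟨v, rfl⟩
  refine Submodule.mem_comap.2 (Submodule.mem_iSup_of_mem (k + 1) ⟨v, ?_⟩)
  rw [← LinearMap.comp_apply, ← Matrix.toLin'_mul, ← Matrix.mul_assoc, pow_succ']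

/-- The uncontrollable part of the dynamics: the map induced by `A` on the quotient of the state
space by the controllable subspace. -/
def uncontrollablePart (A : Matrix (Fin n) (Fin n) ℝ) (B : Matrix (Fin n) (Fin m) ℝ) :
    ((Fin n → ℝ) ⧸ controllableSubspace A B) →ₗ[ℝ] ((Fin n → ℝ) ⧸ controllableSubspace A B) :=
  (controllableSubspace A B).mapQ (controllableSubspace A B) (Matrix.toLin' A)
    (controllableSubspace_le_comap A B)

/-- `(A, B)` is strictly stabilizable: the uncontrollable part of the dynamics is strictly stable,
i.e. all its complex eigenvalues lie in the open unit disc. -/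
def StrictlyStabilizable (A : Matrix (Fin n) (Fin n) ℝ) (B : Matrix (Fin n) (Fin m) ℝ) : Prop :=
  ∀ z : ℂ, ((uncontrollablePart A B).charpoly.map (algebraMap ℝ ℂ)).IsRoot z → ‖z‖ < 1

/-- The control Lyapunov decrease condition for the Minkowski function of `L`. -/
def ControlLyapunov (A : Matrix (Fin n) (Fin n) ℝ) (B : Matrix (Fin n) (Fin m) ℝ)
    (C : Set (EuclideanSpace ℝ (Fin n ⊕ Fin m))) (L : Set (EuclideanSpace ℝ (Fin n))) : Prop :=
  ∀ x : EuclideanSpace ℝ (Fin n), ∃ u : EuclideanSpace ℝ (Fin m),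
    gauge L (Matrix.toEuclideanLin A x + Matrix.toEuclideanLin B u) + gauge C (pair x u)
      ≤ gauge L x

/-- The set `(C^* ⊕ (A B)ᵀ P^*)^*` in `ℝ^{n+m}`. -/
def stepT (A : Matrix (Fin n) (Fin n) ℝ) (B : Matrix (Fin n) (Fin m) ℝ)
    (C : Set (EuclideanSpace ℝ (Fin n ⊕ Fin m))) (P : Set (EuclideanSpace ℝ (Fin n))) :
    Set (EuclideanSpace ℝ (Fin n ⊕ Fin m)) :=
  polar (polar C + matImage (Matrix.fromCols A B).transpose (polar P))

/-- The generator sets: `P_0` is given and `P_{k+1} = P_x (C^* ⊕ (A B)ᵀ P_k^*)^*`. -/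
def genP (A : Matrix (Fin n) (Fin n) ℝ) (B : Matrix (Fin n) (Fin m) ℝ)
    (C : Set (EuclideanSpace ℝ (Fin n ⊕ Fin m))) (P₀ : Set (EuclideanSpace ℝ (Fin n))) :
    ℕ → Set (EuclideanSpace ℝ (Fin n))
  | 0 => P₀
  | k + 1 => matImage (projX n m) (stepT A B C (genP A B C P₀ k))

/-- The set `{0}` is the polar of the whole space, so that the iterates with `P_0^* = {0}` are those
started at the whole space. -/
theorem polar_univ {ι : Type*} [Fintype ι] :
    polar (Set.univ : Set (EuclideanSpace ℝ ι)) = {0} := by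
  ext x
  simp only [polar, Set.mem_univ, forall_const, Set.mem_ofPred_eq, Set.mem_singleton_iff]
  constructor
  · intro h
    by_contra hx
    have hpos : 0 < inner ℝ x x := real_inner_self_pos.2 hx
    have h2 := h ((2 / inner ℝ x x) • x)
    rw [real_inner_smul_left, div_mul_cancel₀ _ hpos.ne'] at h2
    norm_num at h2
  · rintro rfl y
    simp

end MinkowskiBellman

end

open MinkowskiBellman

/-!
Each step `P ↦ P_x (C^* ⊕ (A B)ᵀ P^*)^*` is monotone, so by the Lyapunov condition the upper
iterates increase, the lower iterates decrease, and all iterates started above `L` are squeezed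
between them.

A step also contracts relative gaps. Suppose `C` lies in the ball of radius `R` and the image of `P`
contains the ball of radius `r`. Then `P' ⊆ (1 + d) P` implies the same inclusion between the images
with `d` replaced by `(1 - r / R) d`, because a point `z` of `(C^* ⊕ (A B)ᵀ P'^*)^*` outside the
small ball spends at least `‖z‖ / R ≥ r / R` of its unit budget on the stage cost `g_C`. Hence the
gap between lower and upper iterates decays geometrically.
-/

namespace MinkowskiBellman

section Dilation

theorem subset_smul_of_one_le {𝕜 E : Type*} [Field 𝕜] [LinearOrder 𝕜] [IsStrictOrderedRing 𝕜]
    [AddCommGroup E] [Module 𝕜 E] {X : Set E} (hX : StarConvex 𝕜 0 X) {a : 𝕜} (ha : 1 ≤ a) :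
    X ⊆ a • X := fun _ hx =>
  have ha0 : 0 < a := zero_lt_one.trans_le ha
  (Set.mem_smul_set_iff_inv_smul_mem₀ ha0.ne' _ _).2
    (hX.smul_mem hx (inv_nonneg.2 ha0.le) (inv_le_one_of_one_le₀ ha))

theorem subset_of_subset_smul_of_tendsto_one {α 𝕜 E : Type*} [DivisionRing 𝕜] [TopologicalSpace 𝕜]
    [IsTopologicalDivisionRing 𝕜] [T1Space 𝕜] [AddCommGroup E] [TopologicalSpace E] [Module 𝕜 E]
    [ContinuousSMul 𝕜 E] {X Y : Set E} (hY : IsClosed Y) {l : Filter α} [l.NeBot] {a : α → 𝕜}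
    (ha : Tendsto a l (𝓝 1)) (h : ∀ k, X ⊆ a k • Y) : X ⊆ Y := by
  intro x hx
  have hlim : Tendsto (fun k => (a k)⁻¹ • x) l (𝓝 x) := by
    simpa using (ha.inv₀ one_ne_zero).smul_const x
  refine hY.mem_of_tendsto hlim ?_
  filter_upwards [ha.eventually_ne one_ne_zero] with k hk
  exact (Set.mem_smul_set_iff_inv_smul_mem₀ hk _ _).1 (h k hx)

variable {E : Type*} [SeminormedAddCommGroup E] [NormedSpace ℝ E]

theorem exists_mem_dist_le_of_mem_smul {K : Set E} {a R : ℝ} (hK : K ⊆ Metric.closedBall 0 R)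
    {x : E} (hx : x ∈ a • K) : ∃ y ∈ K, dist x y ≤ |a - 1| * R := by
  obtain ⟨y, hy, rfl⟩ := hx
  refine ⟨y, hy, ?_⟩
  calc dist (a • y) y = |a - 1| * ‖y‖ := by
        rw [dist_eq_norm, ← Real.norm_eq_abs, ← norm_smul, sub_smul, one_smul]
    _ ≤ |a - 1| * R := by gcongr; exact mem_closedBall_zero_iff.1 (hK hy)

theorem hausdorffDist_le_of_sandwich {K S S' : Set E} {a R : ℝ} (hR : 0 ≤ R)
    (hK : K ⊆ Metric.closedBall 0 R) (hKS : K ⊆ S) (hS : S ⊆ a • K) (hKS' : K ⊆ S')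
    (hS' : S' ⊆ a • K) : Metric.hausdorffDist S S' ≤ |a - 1| * R := by
  refine Metric.hausdorffDist_le_of_mem_dist (by positivity) (fun x hx => ?_) fun x hx => ?_
  · obtain ⟨y, hy, h⟩ := exists_mem_dist_le_of_mem_smul hK (hS hx)
    exact ⟨y, hKS' hy, h⟩
  · obtain ⟨y, hy, h⟩ := exists_mem_dist_le_of_mem_smul hK (hS' hx)
    exact ⟨y, hKS hy, h⟩

theorem tendsto_hausdorffDist_of_sandwich {α : Type*} {l : Filter α} {K S : α → Set E} {Y : Set E}
    {a : α → ℝ} {R : ℝ} (ha : Tendsto a l (𝓝 1)) (hR : 0 ≤ R)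
    (hK : ∀ k, K k ⊆ Metric.closedBall 0 R) (hKS : ∀ k, K k ⊆ S k) (hS : ∀ k, S k ⊆ a k • K k)
    (hKY : ∀ k, K k ⊆ Y) (hY : ∀ k, Y ⊆ a k • K k) :
    Tendsto (fun k => Metric.hausdorffDist (S k) Y) l (𝓝 0) := by
  refine squeeze_zero (fun _ => Metric.hausdorffDist_nonneg)
    (fun k => hausdorffDist_le_of_sandwich hR (hK k) (hKS k) (hS k) (hKY k) (hY k)) ?_
  simpa using (ha.sub_const 1).abs.mul_const R

end Dilation

section Polar

variable {ι : Type*} [Fintype ι] {X Y : Set (EuclideanSpace ℝ ι)}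

theorem polar_anti (h : X ⊆ Y) : polar Y ⊆ polar X :=
  fun _ hx y hy => hx y (h hy)

theorem zero_mem_polar (X : Set (EuclideanSpace ℝ ι)) : 0 ∈ polar X := fun y _ => by simp

theorem convex_polar (X : Set (EuclideanSpace ℝ ι)) : Convex ℝ (polar X) := by
  intro x hx y hy a b ha hb hab z hz
  calc inner ℝ z (a • x + b • y) = a * inner ℝ z x + b * inner ℝ z y := by
        rw [inner_add_right, real_inner_smul_right, real_inner_smul_right]
    _ ≤ a * 1 + b * 1 := by gcongr <;> [exact hx z hz; exact hy z hz]
    _ = 1 := by rw [mul_one, mul_one, hab]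

theorem isClosed_polar (X : Set (EuclideanSpace ℝ ι)) : IsClosed (polar X) := by
  have : polar X = ⋂ y ∈ X, {x | inner ℝ y x ≤ 1} := by
    ext x; simp [polar]
  rw [this]
  exact isClosed_biInter fun y _ => isClosed_le (by fun_prop) continuous_const

theorem starConvex_polar (X : Set (EuclideanSpace ℝ ι)) : StarConvex ℝ 0 (polar X) :=
  (convex_polar X).starConvex (zero_mem_polar X)

theorem polar_smul {a : ℝ} (ha : a ≠ 0) (X : Set (EuclideanSpace ℝ ι)) :
    polar (a • X) = a⁻¹ • polar X := by
  ext x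
  rw [Set.mem_smul_set_iff_inv_smul_mem₀ (inv_ne_zero ha), inv_inv]
  simp only [polar, Set.mem_ofPred_eq, ← Set.image_smul, Set.forall_mem_image,
    real_inner_smul_left, real_inner_smul_right]

theorem closedBall_inv_subset_polar {R : ℝ} (hX : X ⊆ Metric.closedBall 0 R) :
    Metric.closedBall 0 R⁻¹ ⊆ polar X := by
  intro x hx y hy
  have hyR : ‖y‖ ≤ R := mem_closedBall_zero_iff.1 (hX hy)
  have hR : 0 ≤ R := (norm_nonneg y).trans hyR
  calc inner ℝ y x ≤ ‖y‖ * ‖x‖ := real_inner_le_norm y x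
    _ ≤ R * R⁻¹ := by gcongr; exact mem_closedBall_zero_iff.1 hx
    _ ≤ 1 := mul_inv_le_one

theorem polar_subset_closedBall_inv {r : ℝ} (hr : 0 < r) (hX : Metric.closedBall 0 r ⊆ X) :
    polar X ⊆ Metric.closedBall 0 r⁻¹ := by
  intro x hx
  rw [mem_closedBall_zero_iff]
  rcases eq_or_ne x 0 with rfl | h0
  · simp [hr.le]
  have hn : 0 < ‖x‖ := norm_pos_iff.2 h0
  have hmem : (r / ‖x‖) • x ∈ X := hX <| mem_closedBall_zero_iff.2 <| by
    rw [norm_smul, Real.norm_of_nonneg (by positivity), div_mul_cancel₀ _ hn.ne']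
  rw [← one_div, le_div_iff₀ hr]
  calc ‖x‖ * r = inner ℝ ((r / ‖x‖) • x) x := by
        rw [real_inner_smul_left, real_inner_self_eq_norm_sq]; field_simp
    _ ≤ 1 := hx _ hmem

theorem polar_mem_nhds_zero (hX : Bornology.IsBounded X) : polar X ∈ 𝓝 0 := by
  obtain ⟨R, hR, hXR⟩ := hX.subset_closedBall_lt 0 0
  exact mem_of_superset (Metric.closedBall_mem_nhds 0 (inv_pos.2 hR))
    (closedBall_inv_subset_polar hXR)

theorem isBounded_polar (hX : X ∈ 𝓝 0) : Bornology.IsBounded (polar X) := by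
  obtain ⟨r, hr, hrX⟩ := Metric.nhds_basis_closedBall.mem_iff.1 hX
  exact Metric.isBounded_closedBall.subset (polar_subset_closedBall_inv hr hrX)

theorem isCSet_polar (hX : X ∈ 𝓝 0) : IsCSet (polar X) where
  isCompact := Metric.isCompact_of_isClosed_isBounded (isClosed_polar X) (isBounded_polar hX)
  convex := convex_polar X
  zero_mem := zero_mem_polar X

theorem inner_le_gauge_of_mem_polar (hX : Absorbent ℝ X) {c : EuclideanSpace ℝ ι}
    (hc : c ∈ polar X) (z : EuclideanSpace ℝ ι) : inner ℝ c z ≤ gauge X z := by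
  refine le_csInf hX.gauge_set_nonempty ?_
  rintro r ⟨hr, y, hy, rfl⟩
  calc inner ℝ c (r • y) = r * inner ℝ y c := by rw [real_inner_smul_right, real_inner_comm]
    _ ≤ r := mul_le_of_le_one_right hr.le (hc y hy)

end Polar

section CSet

variable {ι κ : Type*} [Fintype ι]

theorem IsCSet.starConvex {X : Set (EuclideanSpace ℝ ι)} (hX : IsCSet X) : StarConvex ℝ 0 X :=
  hX.convex.starConvex hX.zero_mem

theorem IsProperCSet.mem_nhds_zero {X : Set (EuclideanSpace ℝ ι)} (hX : IsProperCSet X) :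
    X ∈ 𝓝 0 :=
  mem_interior_iff_mem_nhds.1 hX.zero_mem_interior

theorem hausdorffTendsto_of_isCSet {S : ℕ → Set (EuclideanSpace ℝ ι)}
    {Y : Set (EuclideanSpace ℝ ι)} (hS : ∀ k, IsCSet (S k)) (hY : IsCSet Y)
    (h : Tendsto (fun k => Metric.hausdorffDist (S k) Y) atTop (𝓝 0)) : HausdorffTendsto S Y where
  terms k := ⟨⟨0, (hS k).zero_mem⟩, (hS k).isCompact, (hS k).convex⟩
  limit := ⟨⟨0, hY.zero_mem⟩, hY.isCompact, hY.convex⟩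
  tendsto := h

variable [Fintype κ] [DecidableEq κ]

theorem matImage_smul (M : Matrix ι κ ℝ) (a : ℝ) (X : Set (EuclideanSpace ℝ κ)) :
    matImage M (a • X) = a • matImage M X :=
  Set.image_smul_comm _ _ _ fun x => map_smul _ a x

theorem isBounded_matImage (M : Matrix ι κ ℝ) {X : Set (EuclideanSpace ℝ κ)}
    (hX : Bornology.IsBounded X) : Bornology.IsBounded (matImage M X) :=
  (LinearMap.toContinuousLinearMap (Matrix.toEuclideanLin M)).lipschitz.isBounded_image hX

theorem IsCSet.matImage (M : Matrix ι κ ℝ) {X : Set (EuclideanSpace ℝ κ)} (hX : IsCSet X) :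
    IsCSet (matImage M X) where
  isCompact := hX.isCompact.image (LinearMap.continuous_of_finiteDimensional _)
  convex := hX.convex.linear_image (Matrix.toEuclideanLin M)
  zero_mem := ⟨0, hX.zero_mem, map_zero _⟩

end CSet

section Pair

variable {n m : ℕ}

theorem toEuclideanLin_projX_pair (x : EuclideanSpace ℝ (Fin n)) (u : EuclideanSpace ℝ (Fin m)) :
    Matrix.toEuclideanLin (projX n m) (pair x u) = x := by
  ext i
  simp [projX, pair, Matrix.toLpLin_apply, Matrix.fromCols_mulVec]

theorem toEuclideanLin_fromCols_pair (A : Matrix (Fin n) (Fin n) ℝ) (B : Matrix (Fin n) (Fin m) ℝ)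
    (x : EuclideanSpace ℝ (Fin n)) (u : EuclideanSpace ℝ (Fin m)) :
    Matrix.toEuclideanLin (Matrix.fromCols A B) (pair x u)
      = Matrix.toEuclideanLin A x + Matrix.toEuclideanLin B u := by
  ext i
  simp [pair, Matrix.toLpLin_apply, Matrix.fromCols_mulVec]

theorem norm_toEuclideanLin_projX_le (z : EuclideanSpace ℝ (Fin n ⊕ Fin m)) :
    ‖Matrix.toEuclideanLin (projX n m) z‖ ≤ ‖z‖ := by
  have hproj : ∀ i, Matrix.toEuclideanLin (projX n m) z i = z (Sum.inl i) := fun i => by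
    simp [projX, Matrix.toLpLin_apply, Matrix.fromCols_mulVec]
  rw [EuclideanSpace.norm_eq, EuclideanSpace.norm_eq, Fintype.sum_sum_type]
  simp only [hproj]
  exact Real.sqrt_le_sqrt (le_add_of_nonneg_right (Finset.sum_nonneg fun _ _ => by positivity))

end Pair

variable {n m : ℕ} {A : Matrix (Fin n) (Fin n) ℝ} {B : Matrix (Fin n) (Fin m) ℝ}
  {C : Set (EuclideanSpace ℝ (Fin n ⊕ Fin m))} {P P' L : Set (EuclideanSpace ℝ (Fin n))}

section StepT

theorem mem_stepT {z : EuclideanSpace ℝ (Fin n ⊕ Fin m)} :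
    z ∈ stepT A B C P ↔ ∀ c ∈ polar C, ∀ p ∈ polar P,
      inner ℝ c z + inner ℝ p (Matrix.toEuclideanLin (Matrix.fromCols A B) z) ≤ 1 := by
  have adjoint_inner (p) : inner ℝ (Matrix.toEuclideanLin (Matrix.fromCols A B).transpose p) z
      = inner ℝ p (Matrix.toEuclideanLin (Matrix.fromCols A B) z) := by
    rw [← LinearMap.adjoint_inner_left, ← Matrix.toEuclideanLin_conjTranspose_eq_adjoint,
      Matrix.conjTranspose_eq_transpose_of_trivial]
  simp only [stepT, matImage, polar, Set.mem_ofPred_eq, ← Set.image2_add, Set.forall_mem_image2,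
    Set.forall_mem_image, inner_add_left, adjoint_inner]

theorem stepT_mono : Monotone (stepT A B C) := fun _ _ h =>
  polar_anti (Set.add_subset_add_left (Set.image_mono (polar_anti h)))

theorem stepT_smul_subset {a : ℝ} (ha : 1 ≤ a) : stepT A B C (a • P) ⊆ a • stepT A B C P := by
  have ha0 : a ≠ 0 := by positivity
  have hC : a⁻¹ • polar C ⊆ polar C :=
    (Set.smul_set_subset_iff₀ (inv_ne_zero ha0)).2
      (by simpa using subset_smul_of_one_le (starConvex_polar C) ha)
  calc stepT A B C (a • P)
      = polar (polar C + a⁻¹ • matImage (Matrix.fromCols A B).transpose (polar P)) := by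
        rw [stepT, polar_smul ha0, matImage_smul]
    _ ⊆ polar (a⁻¹ • (polar C + matImage (Matrix.fromCols A B).transpose (polar P))) :=
        polar_anti (by rw [smul_add]; exact Set.add_subset_add_right hC)
    _ = a • stepT A B C P := by rw [polar_smul (inv_ne_zero ha0), inv_inv, stepT]

theorem stepT_subset_smul {a : ℝ} (ha : 1 ≤ a) (h : P' ⊆ a • P) :
    stepT A B C P' ⊆ a • stepT A B C P :=
  (stepT_mono h).trans (stepT_smul_subset ha)

theorem polar_subset_polar_add_matImage :
    polar C ⊆ polar C + matImage (Matrix.fromCols A B).transpose (polar P) :=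
  Set.subset_add_left _ ⟨0, zero_mem_polar P, map_zero _⟩

theorem stepT_subset_closedBall {R : ℝ} (hR : 0 < R) (hC : C ⊆ Metric.closedBall 0 R) :
    stepT A B C P ⊆ Metric.closedBall 0 R :=
  calc stepT A B C P ⊆ polar (polar C) := polar_anti polar_subset_polar_add_matImage
    _ ⊆ Metric.closedBall 0 R⁻¹⁻¹ :=
        polar_subset_closedBall_inv (inv_pos.2 hR) (closedBall_inv_subset_polar hC)
    _ = Metric.closedBall 0 R := by rw [inv_inv]

theorem isCSet_stepT (hC : Bornology.IsBounded C) (P : Set (EuclideanSpace ℝ (Fin n))) :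
    IsCSet (stepT A B C P) :=
  isCSet_polar (mem_of_superset (polar_mem_nhds_zero hC) polar_subset_polar_add_matImage)

theorem isProperCSet_stepT (hC : Bornology.IsBounded C) (hC0 : C ∈ 𝓝 0) (hP : P ∈ 𝓝 0) :
    IsProperCSet (stepT A B C P) where
  toIsCSet := isCSet_stepT hC P
  zero_mem_interior := mem_interior_iff_mem_nhds.2 <| polar_mem_nhds_zero <|
    (isBounded_polar hC0).add (isBounded_matImage _ (isBounded_polar hP))

-- Test the membership of `z` against the polar vector `z / (R ‖z‖)` of `C`.
theorem inner_add_norm_div_le_one_of_mem_stepT {R : ℝ} (hR : 0 < R)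
    (hC : C ⊆ Metric.closedBall 0 R) {z : EuclideanSpace ℝ (Fin n ⊕ Fin m)}
    (hz : z ∈ stepT A B C P) {p : EuclideanSpace ℝ (Fin n)} (hp : p ∈ polar P) :
    inner ℝ p (Matrix.toEuclideanLin (Matrix.fromCols A B) z) + ‖z‖ / R ≤ 1 := by
  have hc : (R⁻¹ * ‖z‖⁻¹) • z ∈ polar C := closedBall_inv_subset_polar hC <| by
    rw [mem_closedBall_zero_iff, norm_smul, Real.norm_of_nonneg (by positivity), mul_assoc]
    exact mul_le_of_le_one_right (by positivity) inv_mul_le_one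
  have hcz : inner ℝ ((R⁻¹ * ‖z‖⁻¹) • z) z = ‖z‖ / R := by
    rw [real_inner_smul_left, real_inner_self_eq_norm_mul_norm]
    field_simp
  rw [add_comm, ← hcz]
  exact mem_stepT.1 hz _ hc p hp

theorem mem_smul_stepT_of_le_norm {R r d : ℝ} (hR : 0 < R) (hC : C ⊆ Metric.closedBall 0 R)
    (hrR : r ≤ R) (hd : 0 ≤ d) (h : P' ⊆ (1 + d) • P) {z : EuclideanSpace ℝ (Fin n ⊕ Fin m)}
    (hz : z ∈ stepT A B C P') (hrz : r ≤ ‖z‖) :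
    z ∈ (1 + (1 - r / R) * d) • stepT A B C P := by
  have hq : 0 ≤ 1 - r / R := sub_nonneg.2 ((div_le_one hR).2 hrR)
  have hd1 : 0 < 1 + d := by positivity
  have ha : 0 < 1 + (1 - r / R) * d := by positivity
  refine (Set.mem_smul_set_iff_inv_smul_mem₀ ha.ne' _ _).2 (mem_stepT.2 fun c hc p hp => ?_)
  set t := inner ℝ p (Matrix.toEuclideanLin (Matrix.fromCols A B) z) with ht
  have hp' : (1 + d)⁻¹ • p ∈ polar P' :=
    polar_anti h (polar_smul hd1.ne' P ▸ Set.smul_mem_smul_set hp)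
  have hstage : (1 + d)⁻¹ * t ≤ 1 - r / R := by
    have hnorm := inner_add_norm_div_le_one_of_mem_stepT hR hC hz hp'
    rw [real_inner_smul_left] at hnorm
    have : r / R ≤ ‖z‖ / R := by gcongr
    linarith
  have htotal : inner ℝ c z + (1 + d)⁻¹ * t ≤ 1 := by
    simpa only [real_inner_smul_left] using mem_stepT.1 hz c hc _ hp'
  rw [map_smul, real_inner_smul_right, real_inner_smul_right, ← ht, ← mul_add,
    inv_mul_le_one₀ ha]
  calc inner ℝ c z + t = inner ℝ c z + (1 + d)⁻¹ * t + (1 + d)⁻¹ * t * d := by field_simp; ring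
    _ ≤ 1 + (1 - r / R) * d := by gcongr

end StepT

section StepP

/-- The Minkowski–Bellman set map `P ↦ P_x (C^* ⊕ (A B)ᵀ P^*)^*`, whose iterates are the generator
sets `genP` and whose fixed points are the solutions of the fixed point set equation. -/
def stepP (A : Matrix (Fin n) (Fin n) ℝ) (B : Matrix (Fin n) (Fin m) ℝ)
    (C : Set (EuclideanSpace ℝ (Fin n ⊕ Fin m))) (P : Set (EuclideanSpace ℝ (Fin n))) :
    Set (EuclideanSpace ℝ (Fin n)) :=
  matImage (projX n m) (stepT A B C P)

theorem stepP_mono : Monotone (stepP A B C) := fun _ _ h => Set.image_mono (stepT_mono h)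

theorem isCSet_stepP (hC : Bornology.IsBounded C) (P : Set (EuclideanSpace ℝ (Fin n))) :
    IsCSet (stepP A B C P) :=
  (isCSet_stepT hC P).matImage _

theorem stepP_subset_closedBall {R : ℝ} (hR : 0 < R) (hC : C ⊆ Metric.closedBall 0 R) :
    stepP A B C P ⊆ Metric.closedBall 0 R := by
  rintro _ ⟨z, hz, rfl⟩
  exact mem_closedBall_zero_iff.2 <| (norm_toEuclideanLin_projX_le z).trans <|
    mem_closedBall_zero_iff.1 (stepT_subset_closedBall hR hC hz)

theorem ControlLyapunov.subset_stepP (h : ControlLyapunov A B C L) (hC : Absorbent ℝ C)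
    (hL : Absorbent ℝ L) : L ⊆ stepP A B C L := by
  intro x hx
  obtain ⟨u, hu⟩ := h x
  refine ⟨pair x u, mem_stepT.2 fun c hc p hp => ?_, toEuclideanLin_projX_pair x u⟩
  rw [toEuclideanLin_fromCols_pair]
  linarith [inner_le_gauge_of_mem_polar hC hc (pair x u),
    inner_le_gauge_of_mem_polar hL hp (Matrix.toEuclideanLin A x + Matrix.toEuclideanLin B u),
    gauge_le_one_of_mem hx]

theorem stepP_subset_contracted_smul {R r d : ℝ} (hR : 0 < R) (hC : C ⊆ Metric.closedBall 0 R)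
    (hrR : r ≤ R) (hP : Metric.closedBall 0 r ⊆ stepP A B C P) (hd : 0 ≤ d)
    (h : P' ⊆ (1 + d) • P) :
    stepP A B C P' ⊆ (1 + (1 - r / R) * d) • stepP A B C P := by
  rintro _ ⟨z, hz, rfl⟩
  rcases le_total ‖z‖ r with hzr | hrz
  · have hq : 0 ≤ 1 - r / R := sub_nonneg.2 ((div_le_one hR).2 hrR)
    have hstar : StarConvex ℝ 0 (stepP A B C P) :=
      (isCSet_stepP (Metric.isBounded_closedBall.subset hC) P).starConvex
    refine subset_smul_of_one_le hstar (le_add_of_nonneg_right (by positivity)) (hP ?_)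
    exact mem_closedBall_zero_iff.2 ((norm_toEuclideanLin_projX_le z).trans hzr)
  · rw [stepP, ← matImage_smul]
    exact Set.mem_image_of_mem _ (mem_smul_stepT_of_le_norm hR hC hrR hd h hz hrz)

end StepP

section Iterates

theorem genP_eq_iterate (P₀ : Set (EuclideanSpace ℝ (Fin n))) (k : ℕ) :
    genP A B C P₀ k = (stepP A B C)^[k] P₀ := by
  induction k with
  | zero => rfl
  | succ k ih => rw [Function.iterate_succ_apply', ← ih]; rfl

theorem genP_mono (k : ℕ) : Monotone fun P₀ => genP A B C P₀ k := by
  simpa only [genP_eq_iterate] using stepP_mono.iterate k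

theorem genP_monotone_of_subset_stepP (hL : L ⊆ stepP A B C L) : Monotone (genP A B C L) := by
  simpa only [funext (genP_eq_iterate L)] using stepP_mono.monotone_iterate_of_le_map hL

theorem genP_univ_antitone : Antitone (genP A B C Set.univ) := by
  simpa only [funext (genP_eq_iterate Set.univ)] using
    stepP_mono.antitone_iterate_of_map_le (Set.subset_univ _)

theorem isCSet_genP_succ (hC : Bornology.IsBounded C) (P₀ : Set (EuclideanSpace ℝ (Fin n)))
    (k : ℕ) : IsCSet (genP A B C P₀ (k + 1)) :=
  isCSet_stepP hC _

-- The initial factor `R / r` comes from `stepP univ ⊆ closedBall 0 R` and `closedBall 0 r ⊆ L`.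
theorem genP_univ_subset_smul {R r : ℝ} (hr : 0 < r) (hrR : r ≤ R)
    (hC : C ⊆ Metric.closedBall 0 R) (hrL : Metric.closedBall 0 r ⊆ L) (hL : L ⊆ stepP A B C L)
    (k : ℕ) :
    genP A B C Set.univ (k + 1) ⊆ (1 + (1 - r / R) ^ k * (R / r - 1)) • genP A B C L (k + 1) := by
  have hR : 0 < R := hr.trans_le hrR
  have hrk (k : ℕ) : Metric.closedBall 0 r ⊆ genP A B C L k :=
    hrL.trans (genP_monotone_of_subset_stepP hL (Nat.zero_le k))
  induction k with
  | zero =>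
    have hball : Metric.closedBall (0 : EuclideanSpace ℝ (Fin n)) R
        = (R / r) • Metric.closedBall 0 r := by
      rw [smul_closedBall _ _ hr.le, smul_zero, Real.norm_of_nonneg (by positivity),
        div_mul_cancel₀ _ hr.ne']
    rw [pow_zero, one_mul, add_sub_cancel]
    calc genP A B C Set.univ 1 ⊆ Metric.closedBall 0 R := stepP_subset_closedBall hR hC
      _ = (R / r) • Metric.closedBall 0 r := hball
      _ ⊆ (R / r) • genP A B C L 1 := Set.smul_set_mono (hrk 1)
  | succ k ih =>
    have hq : 0 ≤ 1 - r / R := sub_nonneg.2 ((div_le_one hR).2 hrR)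
    have hgap : 0 ≤ R / r - 1 := sub_nonneg.2 ((one_le_div hr).2 hrR)
    rw [pow_succ', mul_assoc]
    exact stepP_subset_contracted_smul hR hC hrR (hrk (k + 2)) (by positivity) ih

theorem exists_genP_univ_subset_smul (hC : Bornology.IsBounded C) (hL0 : L ∈ 𝓝 0)
    (hL : L ⊆ stepP A B C L) :
    ∃ a : ℕ → ℝ, (∀ k, 1 ≤ a k) ∧ Tendsto a atTop (𝓝 1) ∧
      ∀ k, genP A B C Set.univ (k + 1) ⊆ a k • genP A B C L (k + 1) := by
  obtain ⟨r, hr, hrL⟩ := Metric.nhds_basis_closedBall.mem_iff.1 hL0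
  obtain ⟨R, hrR, hCR⟩ := hC.subset_closedBall_lt r 0
  have hR : 0 < R := hr.trans hrR
  have hq : 0 ≤ 1 - r / R := sub_nonneg.2 ((div_le_one hR).2 hrR.le)
  have hq1 : 1 - r / R < 1 := sub_lt_self _ (by positivity)
  have hgap : 0 ≤ R / r - 1 := sub_nonneg.2 ((one_le_div hr).2 hrR.le)
  refine ⟨fun k => 1 + (1 - r / R) ^ k * (R / r - 1),
    fun k => le_add_of_nonneg_right (by positivity), ?_,
    genP_univ_subset_smul hr hrR.le hCR hrL hL⟩
  simpa using
    ((tendsto_pow_atTop_nhds_zero_of_lt_one hq hq1).mul_const (R / r - 1)).const_add 1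

end Iterates

section Limit

/-- The intersection of the lower iterates, which is the common limit `P_∞` of the lower, upper and
arbitrary iterates. -/
def limitP (A : Matrix (Fin n) (Fin n) ℝ) (B : Matrix (Fin n) (Fin m) ℝ)
    (C : Set (EuclideanSpace ℝ (Fin n ⊕ Fin m))) : Set (EuclideanSpace ℝ (Fin n)) :=
  ⋂ k, genP A B C Set.univ k

theorem limitP_subset_genP_univ (k : ℕ) : limitP A B C ⊆ genP A B C Set.univ k :=
  Set.iInter_subset _ k

theorem genP_subset_limitP (hL : L ⊆ stepP A B C L) (k : ℕ) : genP A B C L k ⊆ limitP A B C :=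
  Set.subset_iInter fun j =>
    calc genP A B C L k ⊆ genP A B C L (max k j) :=
          genP_monotone_of_subset_stepP hL (le_max_left k j)
      _ ⊆ genP A B C Set.univ (max k j) := genP_mono _ (Set.subset_univ L)
      _ ⊆ genP A B C Set.univ j := genP_univ_antitone (le_max_right k j)

theorem isProperCSet_limitP (hC : Bornology.IsBounded C) (hL0 : L ∈ 𝓝 0)
    (hL : L ⊆ stepP A B C L) : IsProperCSet (limitP A B C) := by
  have hP0 : limitP A B C ∈ 𝓝 0 := mem_of_superset hL0 (genP_subset_limitP hL 0)
  have hlimit : limitP A B C = ⋂ k, genP A B C Set.univ (k + 1) :=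
    (genP_univ_antitone.iInf_nat_add 1).symm
  refine ⟨⟨?_, ?_, mem_of_mem_nhds hP0⟩, mem_interior_iff_mem_nhds.2 hP0⟩
  · rw [hlimit]
    exact (isCSet_genP_succ hC Set.univ 0).isCompact.of_isClosed_subset
      (isClosed_iInter fun k => (isCSet_genP_succ hC Set.univ k).isCompact.isClosed)
      (Set.iInter_subset _ 0)
  · rw [hlimit]
    exact convex_iInter fun k => (isCSet_genP_succ hC Set.univ k).convex

theorem stepP_limitP (hC : Bornology.IsBounded C) (hL0 : L ∈ 𝓝 0) (hL : L ⊆ stepP A B C L) :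
    stepP A B C (limitP A B C) = limitP A B C := by
  obtain ⟨a, -, ha, hgap⟩ := exists_genP_univ_subset_smul hC hL0 hL
  refine Set.Subset.antisymm (Set.subset_iInter fun k => ?_) ?_
  · exact (stepP_mono (limitP_subset_genP_univ k)).trans (genP_univ_antitone k.le_succ)
  · refine subset_of_subset_smul_of_tendsto_one (isCSet_stepP hC _).isCompact.isClosed ha
      fun k => ?_
    calc limitP A B C ⊆ a k • genP A B C L (k + 1) := (limitP_subset_genP_univ _).trans (hgap k)
      _ ⊆ a k • stepP A B C (limitP A B C) :=
          Set.smul_set_mono (stepP_mono (genP_subset_limitP hL k))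

theorem hausdorffTendsto_genP (hC : Bornology.IsBounded C) (hL0 : L ∈ 𝓝 0)
    (hL : L ⊆ stepP A B C L) (hLP : L ⊆ P) :
    HausdorffTendsto (fun k => genP A B C P (k + 1)) (limitP A B C) := by
  obtain ⟨a, -, ha, hgap⟩ := exists_genP_univ_subset_smul hC hL0 hL
  obtain ⟨R, hR, hCR⟩ := hC.subset_closedBall_lt 0 0
  exact hausdorffTendsto_of_isCSet (isCSet_genP_succ hC P) (isProperCSet_limitP hC hL0 hL).toIsCSet
    (tendsto_hausdorffDist_of_sandwich ha hR.le (fun k => stepP_subset_closedBall hR hCR)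
      (fun k => genP_mono (k + 1) hLP)
      (fun k => (genP_mono (k + 1) (Set.subset_univ P)).trans (hgap k))
      (fun k => genP_subset_limitP hL (k + 1))
      (fun k => (limitP_subset_genP_univ (k + 1)).trans (hgap k)))

theorem hausdorffTendsto_stepT_genP (hC : Bornology.IsBounded C) (hL0 : L ∈ 𝓝 0)
    (hL : L ⊆ stepP A B C L) (hLP : L ⊆ P) :
    HausdorffTendsto (fun k => stepT A B C (genP A B C P k)) (stepT A B C (limitP A B C)) := by
  obtain ⟨a, ha1, ha, hgap⟩ := exists_genP_univ_subset_smul hC hL0 hL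
  obtain ⟨R, hR, hCR⟩ := hC.subset_closedBall_lt 0 0
  refine hausdorffTendsto_of_isCSet (fun k => isCSet_stepT hC _) (isCSet_stepT hC _) ?_
  rw [← tendsto_add_atTop_iff_nat 1]
  exact tendsto_hausdorffDist_of_sandwich ha hR.le (fun k => stepT_subset_closedBall hR hCR)
    (fun k => stepT_mono (genP_mono (k + 1) hLP))
    (fun k => stepT_subset_smul (ha1 k) ((genP_mono (k + 1) (Set.subset_univ P)).trans (hgap k)))
    (fun k => stepT_mono (genP_subset_limitP hL (k + 1)))
    (fun k => stepT_subset_smul (ha1 k) ((limitP_subset_genP_univ (k + 1)).trans (hgap k)))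

end Limit

end MinkowskiBellman

theorem theorem5p2_general {n m : ℕ}
    {A : Matrix (Fin n) (Fin n) ℝ} {B : Matrix (Fin n) (Fin m) ℝ}
    {C : Set (EuclideanSpace ℝ (Fin n ⊕ Fin m))} {L : Set (EuclideanSpace ℝ (Fin n))}
    (hC : Bornology.IsBounded C) (hC0 : C ∈ 𝓝 0) (hL0 : L ∈ 𝓝 0)
    (hLyap : ControlLyapunov A B C L) :
    ∃ Pinf : Set (EuclideanSpace ℝ (Fin n)),
      IsProperCSet Pinf ∧ IsProperCSet (stepT A B C Pinf) ∧
      Pinf = matImage (projX n m) (stepT A B C Pinf) ∧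
      ∀ P₀, L ⊆ P₀ → HausdorffTendsto (fun k => genP A B C P₀ (k + 1)) Pinf ∧
        HausdorffTendsto (fun k => stepT A B C (genP A B C P₀ k)) (stepT A B C Pinf) := by
  have hL : L ⊆ stepP A B C L :=
    hLyap.subset_stepP (absorbent_nhds_zero hC0) (absorbent_nhds_zero hL0)
  have hP := isProperCSet_limitP hC hL0 hL
  exact ⟨limitP A B C, hP, isProperCSet_stepT hC hC0 hP.mem_nhds_zero,
    (stepP_limitP hC hL0 hL).symm, fun P₀ hLP =>
      ⟨hausdorffTendsto_genP hC hL0 hL hLP, hausdorffTendsto_stepT_genP hC hL0 hL hLP⟩⟩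

theorem theorem5p2 (n m : ℕ)
    (A : Matrix (Fin n) (Fin n) ℝ) (B : Matrix (Fin n) (Fin m) ℝ)
    (C : Set (EuclideanSpace ℝ (Fin n ⊕ Fin m)))
    (Qf L : Set (EuclideanSpace ℝ (Fin n)))
    (hAB : StrictlyStabilizable A B)
    (hC : IsProperCSet C)
    (hQf : IsProperCSet Qf)
    (hL : IsProperCSet L)
    (hLyap : ControlLyapunov A B C L)
    (hLQ : L ⊆ Qf) :
    ∃ (Pinf Plow Pup : Set (EuclideanSpace ℝ (Fin n)))
      (Tinf : Set (EuclideanSpace ℝ (Fin n ⊕ Fin m))),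
      -- convergence of the arbitrary iterates `P_{k+1}`, started at `P_0 = Q_f`
      (IsProperCSet Pinf ∧ HausdorffTendsto (fun k => genP A B C Qf (k + 1)) Pinf) ∧
      -- the lower iterates (`P_0^* = {0}`) and the upper iterates (`P_0 = L`) have the same limit
      (HausdorffTendsto (fun k => genP A B C Set.univ (k + 1)) Plow ∧
        HausdorffTendsto (fun k => genP A B C L (k + 1)) Pup ∧
        Pup = Pinf ∧ Pinf = Plow) ∧
      -- convergence of the sets `T_{k+1}`
      (IsProperCSet Tinf ∧
        HausdorffTendsto (fun k => stepT A B C (genP A B C Qf k)) Tinf ∧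
        Tinf = stepT A B C Pinf ∧ Pinf = matImage (projX n m) Tinf) ∧
      -- the fixed point set equation
      Pinf = matImage (projX n m) (stepT A B C Pinf) := by
  obtain ⟨P, hP, hT, hfix, hlim⟩ :=
    theorem5p2_general hC.isCompact.isBounded hC.mem_nhds_zero hL.mem_nhds_zero hLyap
  exact ⟨P, P, P, stepT A B C P, ⟨hP, (hlim Qf hLQ).1⟩,
    ⟨(hlim _ (Set.subset_univ L)).1, (hlim L subset_rfl).1, rfl, rfl⟩,
    ⟨hT, (hlim Qf hLQ).2, rfl, hfix⟩, hfix⟩
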